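/- For $0<\varepsilon<1/2$ put $l=(1/4+\varepsilon^2)^{1/2}$ and define the Koch-like set $\Gamma_\varepsilon\subset\mathbb{R}^2$ as follows. A triangular cap of height $h$ on a segment $[a,b]$ is the closed (filled) triangle with vertices $a$, $b$ and $c+(a+b)/2$, where $|c|=h$ and $\langle c,b-a\rangle=0$. The only cap of stage $0$ has base from $(0,0)$ to $(1,0)$ and third vertex $(1/2,\varepsilon)$. The $2^{n+1}$ caps of stage $n+1$ are the caps of height $l^{n+1}\varepsilon$ on the two short sides (of length $l^{n+1}$) of each cap of stage $n$, placed on the side on which they are contained in that cap. Let $A_n$ be the union of the caps of stage $n$ and $\Gamma_\varepsilon=\bigcap_{n\ge 0}A_n$. Balls $B_\rho(x)$ are open, and $L^{r}$ denotes the set of points at distance less than $r$ from $L$. For $A\subset\mathbb{R}^n$, $\delta>0$ and an integer $j\ge 0$ consider the properties (v) ($\rho_0$-uniform weak $j$-dimensional $\delta$-approximation, $\rho_0>0$) $A$ is contained in some ball of radius $\rho_0$, and for every $y\in A$ and $\rho\in(0,\rho_0]$ there is a $j$-dimensional affine space $L_{y,\rho}$ containing $y$ with $B_\rho(y)\cap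 A\subset L_{y,\rho}^{\delta\rho}$; (ii) (weak $j$-dimensional $\delta$-approximation with local uniformity) for every $y\in A$ there is $\rho_y>0$ such that for all $\rho\in(0,\rho_y]$ and all $x\in B_{\rho_y}(y)$ there is a $j$-dimensional affine space $L_{x,\rho}$ with $B_\rho(x)\cap A\subset L_{x,\rho}^{\delta\rho}$. The set $A$ has locally finite $\mathcal{H}^j$ measure if $\mathcal{H}^j(K\cap A)<\infty$ for every compact $K$, and weak locally finite $\mathcal{H}^j$ measure if every $y\in A$ has a radius $\rho>0$ with $\mathcal{H}^j(B_\rho(y)\cap A)<\infty$. Theorem. (a) For every $\delta>0$ there is $\varepsilon\in(0,1/2)$ such that $\Gamma_\varepsilon$ has property (v) with $j=1$, this $\delta$ and $\rho_0=1$, and also property (ii) with $j=1$ and this $\delta$. (b) For every $\varepsilon\in(0,1/2)$ the Hausdorff dimension of $\Gamma_\varepsilon$ is $-\ln 2/\ln l>1$, and $\Gamma_\varepsilon$ does not have weak locally finite $\mathcal{H}^1$ measure. (c) Hence, for every $\delta>0$, each of the following implications fails for some set $A\subset\mathbb{R}^2$ (with $j=1$): (v)(1): if $A$ has property (v) for some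 $\rho_0>0$, then $\dim A\le 1$; (v)(2): if $A$ has property (v) for some $\rho_0>0$, then $A$ has locally finite $\mathcal{H}^1$ measure, in the weak as well as in the stronger sense; (ii)(1): if $A$ has property (ii), then $\dim A\le 1$; (ii)(2): if $A$ has property (ii), then $A$ has locally finite $\mathcal{H}^1$ measure, in the weak as well as in the stronger sense. -/

import Mathlib

open scoped MeasureTheory

namespace KochType

/-- Euclidean `n`-space. -/
abbrev E (n : ℕ) : Type := EuclideanSpace ℝ (Fin n)

/-- `L` is a `j`-dimensional affine subspace. -/
def IsAffineOfDim {n : ℕ} (j : ℕ) (L : AffineSubspace ℝ (E n)) : Prop :=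
  (L : Set (E n)).Nonempty ∧ Module.finrank ℝ L.direction = j

/-- The `ρ₀`-uniform weak `j`-dimensional `δ`-approximation property, property (v).
Neighbourhoods and balls are open. -/
def UniformWeakApprox {n : ℕ} (j : ℕ) (δ ρ₀ : ℝ) (A : Set (E n)) : Prop :=
  (∃ z : E n, A ⊆ Metric.ball z ρ₀) ∧
    ∀ y ∈ A, ∀ ρ : ℝ, 0 < ρ → ρ ≤ ρ₀ →
      ∃ L : AffineSubspace ℝ (E n), IsAffineOfDim j L ∧ y ∈ L ∧
        Metric.ball y ρ ∩ A ⊆ Metric.thickening (δ * ρ) (L : Set (E n))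

/-- The weak `j`-dimensional `δ`-approximation property with local `ρ_y`-uniformity,
property (ii). -/
def LocallyUniformWeakApprox {n : ℕ} (j : ℕ) (δ : ℝ) (A : Set (E n)) : Prop :=
  ∀ y ∈ A, ∃ ρy : ℝ, 0 < ρy ∧
    ∀ ρ : ℝ, 0 < ρ → ρ ≤ ρy → ∀ x ∈ Metric.ball y ρy,
      ∃ L : AffineSubspace ℝ (E n), IsAffineOfDim j L ∧
        Metric.ball x ρ ∩ A ⊆ Metric.thickening (δ * ρ) (L : Set (E n))

/-- Locally finite `j`-dimensional Hausdorff measure. -/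
def LocallyFiniteHausdorff {n : ℕ} (j : ℕ) (A : Set (E n)) : Prop :=
  ∀ K : Set (E n), IsCompact K → μH[(j : ℝ)] (K ∩ A) < ⊤

/-- Weak locally finite `j`-dimensional Hausdorff measure. -/
def WeakLocallyFiniteHausdorff {n : ℕ} (j : ℕ) (A : Set (E n)) : Prop :=
  ∀ y ∈ A, ∃ ρ : ℝ, 0 < ρ ∧ μH[(j : ℝ)] (Metric.ball y ρ ∩ A) < ⊤

/-- The closed (filled) triangle with vertices `a`, `b`, `p`. -/
def triangle (a b p : E 2) : Set (E 2) := convexHull ℝ {a, b, p}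

/-- `p` is the new vertex of a triangular cap of height `h` on the segment from `a` to `b`:
`p = c + (a + b) / 2` with `|c| = h` and `c` orthogonal to `b - a`. -/
def IsCapVertex (h : ℝ) (a b p : E 2) : Prop :=
  ‖p - midpoint ℝ a b‖ = h ∧ inner ℝ (p - midpoint ℝ a b) (b - a) = 0

/-- The scaling factor `l = (1/4 + ε²)^{1/2}`. -/
noncomputable def scale (ε : ℝ) : ℝ := Real.sqrt (1 / 4 + ε ^ 2)

/-- `IsCap ε n a b p`: the triangle with base from `a` to `b` and top vertex `p` is one of the
`2 ^ n` triangular caps of stage `n`. Stage `0` is the `ε`-cap over the segment from `(0,0)` to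
`(1,0)`; the caps of stage `n + 1` are the caps of height `l ^ (n + 1) * ε` built on the two
short sides of the caps of stage `n`, on the side for which they lie inside the old cap. -/
inductive IsCap (ε : ℝ) : ℕ → E 2 → E 2 → E 2 → Prop
  | zero : IsCap ε 0 !₂[0, 0] !₂[1, 0] !₂[1 / 2, ε]
  | left {n : ℕ} {a b p q : E 2} (h : IsCap ε n a b p)
      (hq : IsCapVertex (scale ε ^ (n + 1) * ε) a p q)
      (hsub : triangle a p q ⊆ triangle a b p) : IsCap ε (n + 1) a p q
  | right {n : ℕ} {a b p q : E 2} (h : IsCap ε n a b p)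
      (hq : IsCapVertex (scale ε ^ (n + 1) * ε) p b q)
      (hsub : triangle p b q ⊆ triangle a b p) : IsCap ε (n + 1) p b q

/-- The `n`-th approximation: the union of all caps of stage `n`. -/
def stage (ε : ℝ) (n : ℕ) : Set (E 2) :=
  {x | ∃ a b p : E 2, IsCap ε n a b p ∧ x ∈ triangle a b p}

/-- The Koch-like set `Γ_ε`. -/
def Gam (ε : ℝ) : Set (E 2) := ⋂ n : ℕ, stage ε n

end KochType

/-!
The two caps inside a cap with vertices `a`, `b` and apex `p` are determined by it: since the base
angles of all caps agree, their new vertices lie on the base `[a, b]`. In the coordinates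
(start, base vector, height vector) the passage to the smaller caps is linear, so the caps of stage
`n` are indexed by binary words of length `n`, and by compactness of the space of infinite words a
point lies in the Koch-like set exactly if it lies in all caps along some infinite address
(`mem_Gam_iff`). What carries both halves of the theorem is the position of the two smaller caps:
they meet only at `p`, and each lies in a cone at `p`, on its own side of the line through `p`
along the height and of slope `O(ε)` over the direction of the base.

*Flatness* (`exists_direction`). Given a subset of the Koch-like set of diameter at most `r`, follow
the addresses of its points up to the first digit where two of them differ. All points then lie in
the two smaller caps of one cap, and some two of them on different sides of `p`. As the cones are
disjoint, all points are within `O(r)` of `p`, and the slope of the cones bounds their deviation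
from the direction of the base by `O(ε r)`.

*Dimension.* The `2 ^ n` caps of stage `n` have diameter `O(l ^ n)`, which bounds the dimension
above by the `s` with `l ^ s = 1 / 2` (`dimH_Gam_le`). For the lower bound, assign to each `t` in
the unit interval the point whose address is a binary expansion of `t`. If the expansions of `t` and
`u` first differ at a digit, the two points lie in the two smaller caps of a common cap, so their
distance is comparable to the sum of their distances to the apex; each of these is at least a
multiple of the `1 / s`-th power of the distance of the parameter to the dyadic midpoint
(`half_mul_rpow_le_dist_start`). Hence the inverse of this parametrization is Hölder continuous
with exponent `s > 1` and has the unit interval as its image (`le_dimH_Gam`). A set of dimension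
greater than one cannot have weakly locally finite one-dimensional measure.
-/

namespace KochType

/-! ### Caps in coordinates along base and height -/

/-- A cap recorded by its starting vertex `start`, its base vector `base` and the vector `height`
from the midpoint of the base to the apex. In these coordinates passing to a smaller cap is linear
in `(start, base, height)`, and no choice of a side of the base has to be made. -/
structure Cap where
  /-- The vertex at which the base starts. -/
  start : E 2
  /-- The vector from the first to the second vertex of the base. -/
  base : E 2
  /-- The vector from the midpoint of the base to the apex. -/
  height : E 2

namespace Cap

/-- The end point of the base. -/
noncomputable def finish (c : Cap) : E 2 := c.start + c.base

/-- The vertex opposite to the base. -/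
noncomputable def apex (c : Cap) : E 2 := c.start + (1 / 2 : ℝ) • c.base + c.height

/-- The filled triangle of a cap. -/
def hull (c : Cap) : Set (E 2) := triangle c.start c.finish c.apex

/-- The two caps on the short sides of a cap: `false` gives the one containing `start`, `true` the
one containing `finish`. Both have their apex on the base of the old cap. -/
noncomputable def child (ε : ℝ) : Bool → Cap → Cap
  | false, c => ⟨c.start, (1 / 2 : ℝ) • c.base + c.height,
      (ε ^ 2) • c.base - (1 / 2 : ℝ) • c.height⟩
  | true, c => ⟨c.apex, (1 / 2 : ℝ) • c.base - c.height,
      -(ε ^ 2) • c.base - (1 / 2 : ℝ) • c.height⟩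

/-- The cap is an isosceles triangle with base length `L` and height `ε * L`. -/
structure HasShape (ε L : ℝ) (c : Cap) : Prop where
  inner_eq : inner ℝ c.base c.height = 0
  norm_base : ‖c.base‖ = L
  norm_height : ‖c.height‖ = ε * L

@[simp] theorem child_false_start (ε : ℝ) (c : Cap) : (child ε false c).start = c.start := rfl

@[simp] theorem child_true_start (ε : ℝ) (c : Cap) : (child ε true c).start = c.apex := rfl

@[simp] theorem child_false_finish (ε : ℝ) (c : Cap) : (child ε false c).finish = c.apex := by
  simp only [finish, apex, child]
  module

@[simp] theorem child_true_finish (ε : ℝ) (c : Cap) : (child ε true c).finish = c.finish := by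
  simp only [finish, apex, child]
  module

theorem child_false_apex (ε : ℝ) (c : Cap) :
    (child ε false c).apex = c.start + (1 / 4 + ε ^ 2) • c.base := by
  simp only [apex, child]
  module

theorem child_true_apex (ε : ℝ) (c : Cap) :
    (child ε true c).apex = c.start + (3 / 4 - ε ^ 2) • c.base := by
  simp only [apex, child]
  module

end Cap

theorem mem_triangle_iff {a b p x : E 2} :
    x ∈ triangle a b p ↔ ∃ s t : ℝ, 0 ≤ s ∧ 0 ≤ t ∧ s + t ≤ 1 ∧
      x = (1 - s - t) • a + s • b + t • p := by
  constructor
  · intro hx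
    rw [triangle, convexHull_insert (by simp), convexHull_pair] at hx
    simp only [convexJoin_singleton_left, Set.mem_iUnion, exists_prop] at hx
    obtain ⟨y, ⟨u, v, hu, hv, huv, rfl⟩, ⟨u', v', hu', hv', huv', rfl⟩⟩ := hx
    refine ⟨v' * u, v' * v, by positivity, by positivity, ?_, ?_⟩
    · rw [← mul_add, huv]
      linarith
    · have h1 : u' = 1 - v' * u - v' * v := by linear_combination huv' + v' * huv
      rw [← h1]
      module
  · rintro ⟨s, t, hs, ht, hst, rfl⟩
    have hc : Convex ℝ (triangle a b p) := convex_convexHull _ _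
    have ha : a ∈ triangle a b p := subset_convexHull _ _ (by simp)
    have hb : b ∈ triangle a b p := subset_convexHull _ _ (by simp)
    have hp : p ∈ triangle a b p := subset_convexHull _ _ (by simp)
    have := hc.sum_mem (t := (Finset.univ : Finset (Fin 3))) (w := ![1 - s - t, s, t])
      (z := ![a, b, p]) (by intro i _; fin_cases i <;> simp <;> linarith)
      (by simp [Fin.sum_univ_three]; ring) (by intro i _; fin_cases i <;> simp <;> assumption)
    simpa [Fin.sum_univ_three] using this

theorem abs_mul_norm_le_norm_add {v h : E 2} (hvh : inner ℝ v h = 0) (α β : ℝ) :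
    |α| * ‖v‖ ≤ ‖α • v + β • h‖ := by
  have h1 := norm_add_sq_real (α • v) (β • h)
  rw [real_inner_smul_left, real_inner_smul_right, hvh] at h1
  rw [← Real.norm_eq_abs, ← norm_smul]
  refine abs_le_of_sq_le_sq' ?_ (norm_nonneg _) |>.2
  nlinarith [sq_nonneg ‖β • h‖]

namespace Cap

variable {ε L : ℝ} {c : Cap}

/-- In the hull, the coordinates of a point relative to base and height. -/
theorem mem_hull_iff {x : E 2} : x ∈ c.hull ↔ ∃ s t : ℝ, 0 ≤ s ∧ 0 ≤ t ∧ s + t ≤ 1 ∧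
    x = c.start + (s + t / 2) • c.base + t • c.height := by
  rw [hull, mem_triangle_iff]
  refine exists_congr fun s => exists_congr fun t => and_congr_right fun _ =>
    and_congr_right fun _ => and_congr_right fun _ => ?_
  rw [show (1 - s - t) • c.start + s • c.finish + t • c.apex =
    c.start + (s + t / 2) • c.base + t • c.height by simp only [finish, apex]; module]

/-- The first smaller cap lies in the cone at the apex that opens towards `start`. Along the cone the
base coordinate is at least `1 / 4 - ε ^ 2` times the height coordinate, so the cone makes a positive
angle with the height. -/
theorem exists_eq_of_mem_hull_child_false {x : E 2}
    (hx : x ∈ (child ε false c).hull) : ∃ A B : ℝ, (1 / 4 - ε ^ 2) * B ≤ A ∧ 0 ≤ B ∧ A ≤ B ∧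
      x = c.apex - A • c.base - B • c.height := by
  obtain ⟨s, t, hs, ht, hst, rfl⟩ := mem_triangle_iff.1 hx
  have h2 := sq_nonneg ε
  refine ⟨(1 - s - t) / 2 + t * (1 / 4 - ε ^ 2), 1 - s, ?_, by linarith, ?_, ?_⟩
  · nlinarith
  · nlinarith
  · rw [child_false_finish, child_false_apex]
    simp only [apex, child]
    module

/-- The second smaller cap lies in the mirror image of the cone of the first one. -/
theorem exists_eq_of_mem_hull_child_true {x : E 2}
    (hx : x ∈ (child ε true c).hull) : ∃ A B : ℝ, (1 / 4 - ε ^ 2) * B ≤ A ∧ 0 ≤ B ∧ A ≤ B ∧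
      x = c.apex + A • c.base - B • c.height := by
  obtain ⟨s, t, hs, ht, hst, rfl⟩ := mem_triangle_iff.1 hx
  have h2 := sq_nonneg ε
  refine ⟨s / 2 + t * (1 / 4 - ε ^ 2), s + t, ?_, by linarith, ?_, ?_⟩
  · nlinarith
  · nlinarith
  · rw [child_true_finish, child_true_apex]
    simp only [apex, finish, child]
    module

theorem start_mem_hull : c.start ∈ c.hull := subset_convexHull _ _ (by simp)

theorem finish_mem_hull : c.finish ∈ c.hull := subset_convexHull _ _ (by simp)

theorem apex_mem_hull : c.apex ∈ c.hull := subset_convexHull _ _ (by simp)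

theorem hull_child_subset (hε : ε ^ 2 < 1 / 4) (i : Bool) (c : Cap) :
    (child ε i c).hull ⊆ c.hull := by
  have h2 := sq_nonneg ε
  refine convexHull_min ?_ (convex_convexHull _ _)
  cases i
  · rintro x (rfl | rfl | rfl)
    · exact start_mem_hull
    · rw [child_false_finish]
      exact apex_mem_hull
    · rw [child_false_apex]
      exact mem_hull_iff.2 ⟨1 / 4 + ε ^ 2, 0, by linarith, le_rfl, by linarith, by module⟩
  · rintro x (rfl | rfl | rfl)
    · exact apex_mem_hull
    · rw [child_true_finish]
      exact finish_mem_hull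
    · rw [child_true_apex]
      exact mem_hull_iff.2 ⟨3 / 4 - ε ^ 2, 0, by linarith, le_rfl, by linarith, by module⟩

theorem scale_sq (ε : ℝ) : scale ε ^ 2 = 1 / 4 + ε ^ 2 :=
  Real.sq_sqrt (by positivity)

theorem scale_pos (ε : ℝ) : 0 < scale ε := Real.sqrt_pos.2 (by positivity)

/-- The smaller caps are similar to the old one, with ratio `scale ε`. -/
theorem HasShape.hasShape_child (hε : 0 ≤ ε) (hL : 0 ≤ L) (h : c.HasShape ε L) (i : Bool) :
    (child ε i c).HasShape ε (scale ε * L) := by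
  obtain ⟨h1, h2, h3⟩ := h
  have hs := scale_pos ε
  have hsq := scale_sq ε
  have h1' : inner ℝ c.height c.base = 0 := by rw [real_inner_comm, h1]
  have hb : inner ℝ c.base c.base = L ^ 2 := by rw [real_inner_self_eq_norm_sq, h2]
  have hh : inner ℝ c.height c.height = (ε * L) ^ 2 := by rw [real_inner_self_eq_norm_sq, h3]
  cases i
  all_goals
    refine ⟨?_, ?_, ?_⟩
    · simp only [Cap.child, inner_add_left, inner_sub_right, inner_sub_left, real_inner_smul_left,
        real_inner_smul_right, h1, h1', hb, hh]
      ring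
    · rw [← sq_eq_sq₀ (norm_nonneg _) (by positivity), ← real_inner_self_eq_norm_sq]
      simp only [Cap.child, inner_add_left, inner_add_right, inner_sub_right, inner_sub_left,
        real_inner_smul_left, real_inner_smul_right, h1, h1', hb, hh, mul_pow, hsq]
      ring
    · rw [← sq_eq_sq₀ (norm_nonneg _) (by positivity), ← real_inner_self_eq_norm_sq]
      simp only [Cap.child, inner_sub_right, inner_sub_left, real_inner_smul_left,
        real_inner_smul_right, h1, h1', hb, hh, mul_pow, hsq]
      ring

theorem HasShape.dist_le (h : c.HasShape ε L) (hε : 0 ≤ ε) (hε' : ε ≤ 1) (hL : 0 ≤ L)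
    {x y : E 2} (hx : x ∈ c.hull) (hy : y ∈ c.hull) : dist x y ≤ 2 * L := by
  obtain ⟨s, t, hs, ht, hst, rfl⟩ := mem_hull_iff.1 hx
  obtain ⟨s', t', hs', ht', hst', rfl⟩ := mem_hull_iff.1 hy
  rw [dist_eq_norm, show c.start + (s + t / 2) • c.base + t • c.height -
    (c.start + (s' + t' / 2) • c.base + t' • c.height) =
    (s + t / 2 - (s' + t' / 2)) • c.base + (t - t') • c.height by module]
  refine (norm_add_le _ _).trans ?_
  rw [norm_smul, norm_smul, h.norm_base, h.norm_height, Real.norm_eq_abs, Real.norm_eq_abs]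
  have h1 : |s + t / 2 - (s' + t' / 2)| ≤ 1 := by rw [abs_le]; constructor <;> linarith
  have h2 : |t - t'| ≤ 1 := by rw [abs_le]; constructor <;> linarith
  have h3 : ε * L ≤ L := by nlinarith
  nlinarith [mul_nonneg hε hL]

/-- Points of the second smaller cap stay away from `start`. -/
theorem HasShape.half_le_dist_start (h : c.HasShape ε L) (hε : ε ^ 2 < 1 / 4) (hL : 0 ≤ L)
    {x : E 2} (hx : x ∈ (Cap.child ε true c).hull) : L / 2 ≤ dist x c.start := by
  obtain ⟨A, B, hAB, hB, -, rfl⟩ := exists_eq_of_mem_hull_child_true hx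
  have h1 := abs_mul_norm_le_norm_add h.inner_eq (1 / 2 + A) (1 - B)
  have hA : 0 ≤ A := le_trans (mul_nonneg (by linarith) hB) hAB
  rw [h.norm_base, abs_of_nonneg (by linarith)] at h1
  rw [dist_eq_norm, show c.apex + A • c.base - B • c.height - c.start =
    (1 / 2 + A) • c.base + (1 - B) • c.height by simp only [apex]; module]
  nlinarith

/-- Points of the first smaller cap stay away from `finish`. -/
theorem HasShape.half_le_dist_finish (h : c.HasShape ε L) (hε : ε ^ 2 < 1 / 4) (hL : 0 ≤ L)
    {x : E 2} (hx : x ∈ (Cap.child ε false c).hull) : L / 2 ≤ dist x c.finish := by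
  obtain ⟨A, B, hAB, hB, -, rfl⟩ := exists_eq_of_mem_hull_child_false hx
  have h1 := abs_mul_norm_le_norm_add h.inner_eq (1 / 2 + A) (B - 1)
  have hA : 0 ≤ A := le_trans (mul_nonneg (by linarith) hB) hAB
  rw [h.norm_base, abs_of_nonneg (by linarith)] at h1
  rw [dist_comm, dist_eq_norm, show c.finish - (c.apex - A • c.base - B • c.height) =
    (1 / 2 + A) • c.base + (B - 1) • c.height by simp only [apex, finish]; module]
  nlinarith

/-- The two smaller caps meet at the apex with a positive angle: the distance of a point of one to a
point of the other is comparable to the sum of their distances to the apex. -/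
theorem HasShape.mul_dist_add_dist_le (h : c.HasShape ε L) (hε0 : 0 ≤ ε) (hε : ε < 1 / 2)
    (hL : 0 ≤ L) {x y : E 2} (hx : x ∈ (Cap.child ε false c).hull)
    (hy : y ∈ (Cap.child ε true c).hull) :
    (1 / 4 - ε ^ 2) / 2 * (dist x c.apex + dist y c.apex) ≤ dist x y := by
  have hε2 : ε ^ 2 < 1 / 4 := by nlinarith
  obtain ⟨A, B, hAB, hB, hA, rfl⟩ := exists_eq_of_mem_hull_child_false hx
  obtain ⟨A', B', hAB', hB', hA', rfl⟩ := exists_eq_of_mem_hull_child_true hy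
  have hA0 : 0 ≤ A := le_trans (mul_nonneg (by linarith) hB) hAB
  have hA0' : 0 ≤ A' := le_trans (mul_nonneg (by linarith) hB') hAB'
  have h1 := abs_mul_norm_le_norm_add h.inner_eq (A + A') (B - B')
  rw [h.norm_base, abs_of_nonneg (by linarith)] at h1
  have hx' : dist (c.apex - A • c.base - B • c.height) c.apex ≤ 2 * B * L := by
    rw [dist_comm, dist_eq_norm, show c.apex - (c.apex - A • c.base - B • c.height) =
      A • c.base + B • c.height by module]
    refine (norm_add_le _ _).trans ?_
    rw [norm_smul, norm_smul, h.norm_base, h.norm_height, Real.norm_of_nonneg hA0,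
      Real.norm_of_nonneg hB]
    nlinarith [mul_nonneg hB hL]
  have hy' : dist (c.apex + A' • c.base - B' • c.height) c.apex ≤ 2 * B' * L := by
    rw [dist_eq_norm, show c.apex + A' • c.base - B' • c.height - c.apex =
      A' • c.base + (-B') • c.height by module]
    refine (norm_add_le _ _).trans ?_
    rw [norm_smul, norm_smul, h.norm_base, h.norm_height, Real.norm_of_nonneg hA0', norm_neg,
      Real.norm_of_nonneg hB']
    nlinarith [mul_nonneg hB' hL]
  rw [show (A + A') • c.base + (B - B') • c.height = c.apex + A' • c.base - B' • c.height -
    (c.apex - A • c.base - B • c.height) by module, ← dist_eq_norm, dist_comm] at h1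
  calc (1 / 4 - ε ^ 2) / 2 * _ ≤ (1 / 4 - ε ^ 2) / 2 * (2 * B * L + 2 * B' * L) := by
        gcongr
    _ = ((1 / 4 - ε ^ 2) * B + (1 / 4 - ε ^ 2) * B') * L := by ring
    _ ≤ (A + A') * L := by gcongr
    _ ≤ _ := h1

/-- If two points of a set inside the union of the two smaller caps are separated by the apex, then
the set is close to the apex compared to its diameter, and the slope of the two cones bounds the
deviation from the direction of the base. -/
theorem HasShape.exists_norm_sub_smul_base_le (h : c.HasShape ε L) (hε0 : 0 ≤ ε) (hε : ε < 1 / 2)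
    (hL : 0 < L) {r : ℝ} {S : Set (E 2)} (hr : ∀ x ∈ S, ∀ y ∈ S, dist x y ≤ r)
    (hS : ∀ x ∈ S, x ∈ (Cap.child ε false c).hull ∨ x ∈ (Cap.child ε true c).hull)
    (h0 : ∃ x ∈ S, x ∈ (Cap.child ε false c).hull) (h1 : ∃ x ∈ S, x ∈ (Cap.child ε true c).hull) :
    ∀ x ∈ S, ∀ y ∈ S, ∃ k : ℝ, ‖x - y - k • c.base‖ ≤ ε / (1 / 4 - ε ^ 2) * r := by
  have hε2 : ε ^ 2 < 1 / 4 := by nlinarith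
  have hκ : 0 < 1 / 4 - ε ^ 2 := by linarith
  have key : ∀ A B A' B' : ℝ, (1 / 4 - ε ^ 2) * B ≤ A → 0 ≤ B → (1 / 4 - ε ^ 2) * B' ≤ A' →
      0 ≤ B' → c.apex - A • c.base - B • c.height ∈ S → c.apex + A' • c.base - B' • c.height ∈ S →
      (1 / 4 - ε ^ 2) * (B + B') * L ≤ r := by
    intro A B A' B' hAB hB hAB' hB' hx hy
    have hA0 : 0 ≤ A := le_trans (mul_nonneg hκ.le hB) hAB
    have hA0' : 0 ≤ A' := le_trans (mul_nonneg hκ.le hB') hAB'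
    have h1 := abs_mul_norm_le_norm_add h.inner_eq (A + A') (B - B')
    rw [h.norm_base, abs_of_nonneg (by linarith)] at h1
    have h2 := hr _ hy _ hx
    rw [dist_eq_norm, show c.apex + A' • c.base - B' • c.height -
      (c.apex - A • c.base - B • c.height) = (A + A') • c.base + (B - B') • c.height by
        module] at h2
    nlinarith
  obtain ⟨x₀, hx₀, hx₀'⟩ := h0
  obtain ⟨x₁, hx₁, hx₁'⟩ := h1
  obtain ⟨A₀, B₀, hAB₀, hB₀, -, rfl⟩ := exists_eq_of_mem_hull_child_false hx₀'
  obtain ⟨A₁, B₁, hAB₁, hB₁, -, rfl⟩ := exists_eq_of_mem_hull_child_true hx₁'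
  have main : ∀ x ∈ S, ∃ A B : ℝ, 0 ≤ B ∧ (1 / 4 - ε ^ 2) * B * L ≤ r ∧
      x = c.apex + A • c.base - B • c.height := by
    intro x hx
    rcases hS x hx with hx' | hx'
    · obtain ⟨A, B, hAB, hB, -, rfl⟩ := exists_eq_of_mem_hull_child_false hx'
      have := key A B A₁ B₁ hAB hB hAB₁ hB₁ hx hx₁
      refine ⟨-A, B, hB, ?_, by module⟩
      nlinarith [mul_nonneg (mul_nonneg hκ.le hB₁) hL.le]
    · obtain ⟨A, B, hAB, hB, -, rfl⟩ := exists_eq_of_mem_hull_child_true hx'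
      have := key A₀ B₀ A B hAB₀ hB₀ hAB hB hx₀ hx
      refine ⟨A, B, hB, ?_, rfl⟩
      nlinarith [mul_nonneg (mul_nonneg hκ.le hB₀) hL.le]
  intro x hx y hy
  obtain ⟨A, B, hB, hBr, rfl⟩ := main x hx
  obtain ⟨A', B', hB', hBr', rfl⟩ := main y hy
  refine ⟨A - A', ?_⟩
  rw [show c.apex + A • c.base - B • c.height - (c.apex + A' • c.base - B' • c.height) -
    (A - A') • c.base = (B' - B) • c.height by module, norm_smul, h.norm_height, Real.norm_eq_abs]
  have h1 : B * L ≤ r / (1 / 4 - ε ^ 2) := by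
    rw [le_div_iff₀ hκ]
    linarith
  have h2 : B' * L ≤ r / (1 / 4 - ε ^ 2) := by
    rw [le_div_iff₀ hκ]
    linarith
  have h3 : |B' - B| * L ≤ r / (1 / 4 - ε ^ 2) := by
    rcases abs_cases (B' - B) with ⟨h, _⟩ | ⟨h, _⟩ <;> rw [h] <;>
      nlinarith [mul_nonneg hB hL.le, mul_nonneg hB' hL.le]
  calc |B' - B| * (ε * L) = ε * (|B' - B| * L) := by ring
    _ ≤ ε * (r / (1 / 4 - ε ^ 2)) := by gcongr
    _ = _ := by ring

end Cap

/-! ### Caps indexed by addresses -/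

/-- The cap of stage `n` reached from the stage `0` cap by the choices `ω 0, …, ω (n - 1)`. -/
noncomputable def capSeq (ε : ℝ) (ω : ℕ → Bool) : ℕ → Cap
  | 0 => ⟨!₂[0, 0], !₂[1, 0], !₂[0, ε]⟩
  | n + 1 => (capSeq ε ω n).child ε (ω n)

variable {ε L : ℝ}

theorem capSeq_zero_finish (ω : ℕ → Bool) : (capSeq ε ω 0).finish = !₂[1, 0] := by
  ext i
  fin_cases i <;> simp [capSeq, Cap.finish]

theorem capSeq_zero_apex (ω : ℕ → Bool) : (capSeq ε ω 0).apex = !₂[1 / 2, ε] := by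
  ext i
  fin_cases i <;> simp [capSeq, Cap.apex]

theorem capSeq_congr {ω ω' : ℕ → Bool} {n : ℕ} (h : ∀ i < n, ω i = ω' i) :
    capSeq ε ω n = capSeq ε ω' n := by
  induction n with
  | zero => rfl
  | succ n ih => rw [capSeq, capSeq, ih fun i hi => h i (by omega), h n (by omega)]

theorem hasShape_capSeq (hε : 0 ≤ ε) (ω : ℕ → Bool) (n : ℕ) :
    (capSeq ε ω n).HasShape ε (scale ε ^ n) := by
  induction n with
  | zero =>
    refine ⟨?_, ?_, ?_⟩
    · simp [capSeq, PiLp.inner_apply]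
    · simp [capSeq, EuclideanSpace.norm_eq]
    · simp [capSeq, EuclideanSpace.norm_eq, Real.sqrt_sq hε]
  | succ n ih =>
    rw [pow_succ']
    exact ih.hasShape_child hε (pow_nonneg (Cap.scale_pos ε).le n) _

theorem hull_capSeq_antitone (hε : ε ^ 2 < 1 / 4) (ω : ℕ → Bool) :
    Antitone fun n => (capSeq ε ω n).hull :=
  antitone_nat_of_succ_le fun _ => Cap.hull_child_subset hε _ _

namespace Cap

variable {c : Cap}

theorem finish_sub_start (c : Cap) : c.finish - c.start = c.base := by simp [finish]

theorem apex_sub_midpoint (c : Cap) : c.apex - midpoint ℝ c.start c.finish = c.height := by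
  rw [midpoint_eq_smul_add]
  simp only [apex, finish, invOf_eq_inv]
  module

theorem HasShape.isCapVertex (h : c.HasShape ε L) :
    IsCapVertex (L * ε) c.start c.finish c.apex := by
  rw [IsCapVertex, apex_sub_midpoint, finish_sub_start, real_inner_comm, mul_comm]
  exact ⟨h.norm_height, h.inner_eq⟩

end Cap

theorem eq_or_eq_neg_of_inner_eq_zero {u w w' : E 2} (hu : u ≠ 0) (hw : inner ℝ w u = 0)
    (hw' : inner ℝ w' u = 0) (h : ‖w‖ = ‖w'‖) : w = w' ∨ w = -w' := by
  have hu' : u 0 ^ 2 + u 1 ^ 2 ≠ 0 := by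
    intro h0
    apply hu
    have h1 : u 0 = 0 := by nlinarith [sq_nonneg (u 0), sq_nonneg (u 1)]
    have h2 : u 1 = 0 := by nlinarith [sq_nonneg (u 0), sq_nonneg (u 1)]
    ext i
    fin_cases i <;> simpa
  -- A vector orthogonal to `u` is a multiple of the quarter turn of `u`.
  have key : ∀ w : E 2, inner ℝ w u = 0 → ∃ k : ℝ, w 0 = k * -u 1 ∧ w 1 = k * u 0 := by
    intro w hw
    simp only [PiLp.inner_apply, Fin.sum_univ_two, RCLike.inner_apply, conj_trivial] at hw
    refine ⟨(w 1 * u 0 - w 0 * u 1) / (u 0 ^ 2 + u 1 ^ 2), ?_, ?_⟩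
    · field_simp
      linear_combination u 0 * hw
    · field_simp
      linear_combination u 1 * hw
  obtain ⟨k, h0, h1⟩ := key w hw
  obtain ⟨k', h0', h1'⟩ := key w' hw'
  have hn : ‖w‖ ^ 2 = ‖w'‖ ^ 2 := by rw [h]
  simp only [EuclideanSpace.norm_sq_eq, Fin.sum_univ_two, Real.norm_eq_abs, sq_abs, h0, h1, h0',
    h1'] at hn
  have hk : k ^ 2 = k' ^ 2 := mul_right_cancel₀ hu' (by linear_combination hn)
  rcases sq_eq_sq_iff_eq_or_eq_neg.1 hk with rfl | rfl
  · left
    ext i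
    fin_cases i <;> simp [h0, h1, h0', h1']
  · right
    ext i
    fin_cases i <;> simp [h0, h1, h0', h1']

namespace Cap

variable {c : Cap}

/-- The side condition singles out one of the two possible new vertices. -/
theorem HasShape.eq_apex_child (h : c.HasShape ε L) (hε : 0 < ε) (hL : 0 < L) (i : Bool) {q : E 2}
    (hq : IsCapVertex (scale ε * L * ε) (child ε i c).start (child ε i c).finish q)
    (hsub : q ∈ c.hull) : q = (child ε i c).apex := by
  have hs := scale_pos ε
  have h' := h.hasShape_child hε.le hL.le i
  obtain ⟨hq1, hq2⟩ := hq
  rw [finish_sub_start] at hq2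
  have hb : (child ε i c).base ≠ 0 := by
    rw [← norm_ne_zero_iff, h'.norm_base]
    positivity
  rcases eq_or_eq_neg_of_inner_eq_zero (w' := (child ε i c).height) hb hq2
    (by rw [real_inner_comm, h'.inner_eq]) (by rw [hq1, h'.norm_height, mul_comm]) with heq | heq
  · rw [← apex_sub_midpoint] at heq
    exact sub_left_injective heq
  · exfalso
    have hq : q = (child ε i c).apex - (2 : ℝ) • (child ε i c).height := by
      have := apex_sub_midpoint (child ε i c)
      rw [sub_eq_iff_eq_add] at this heq
      rw [this, heq]
      module
    obtain ⟨s, t, hs, ht, hst, hx⟩ := mem_hull_iff.1 hsub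
    have hb : inner ℝ c.base c.base = L ^ 2 := by rw [real_inner_self_eq_norm_sq, h.norm_base]
    have hh : inner ℝ c.height c.height = (ε * L) ^ 2 := by
      rw [real_inner_self_eq_norm_sq, h.norm_height]
    have indep : ∀ α β : ℝ, α • c.base + β • c.height = 0 → α = 0 ∧ β = 0 := by
      intro α β h0
      have e1 := congrArg (fun z => inner ℝ z c.base) h0
      have e2 := congrArg (fun z => inner ℝ z c.height) h0
      simp only [inner_add_left, real_inner_smul_left, hb, hh, h.inner_eq, inner_zero_left,
        real_inner_comm c.base c.height] at e1 e2
      have : (ε * L) ^ 2 ≠ 0 := by positivity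
      have : L ^ 2 ≠ 0 := by positivity
      constructor <;> simp_all
    rw [hq] at hx
    cases i
    · rw [child_false_apex] at hx
      obtain ⟨h1, h2⟩ := indep (1 / 4 - ε ^ 2 - (s + t / 2)) (1 - t) (by
        rw [← sub_eq_zero] at hx
        rw [← hx]
        simp only [child]
        module)
      nlinarith
    · rw [child_true_apex] at hx
      obtain ⟨h1, h2⟩ := indep (3 / 4 + ε ^ 2 - (s + t / 2)) (1 - t) (by
        rw [← sub_eq_zero] at hx
        rw [← hx]
        simp only [child]
        module)
      nlinarith

end Cap

theorem isCap_capSeq (hε : 0 ≤ ε) (hε2 : ε ^ 2 < 1 / 4) (ω : ℕ → Bool) (n : ℕ) :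
    IsCap ε n (capSeq ε ω n).start (capSeq ε ω n).finish (capSeq ε ω n).apex := by
  induction n with
  | zero =>
    rw [capSeq_zero_finish, capSeq_zero_apex]
    exact IsCap.zero
  | succ n ih =>
    have h1 := (hasShape_capSeq hε ω (n + 1)).isCapVertex
    have h2 := Cap.hull_child_subset hε2 (ω n) (capSeq ε ω n)
    simp only [capSeq] at h1 ⊢
    cases hω : ω n
    · simp only [hω, Cap.hull] at h1 h2 ⊢
      simp only [Cap.child_false_finish, Cap.child_false_start] at h1 h2 ⊢
      exact IsCap.left ih h1 h2
    · simp only [hω, Cap.hull] at h1 h2 ⊢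
      simp only [Cap.child_true_finish, Cap.child_true_start] at h1 h2 ⊢
      exact IsCap.right ih h1 h2

theorem IsCap.exists_capSeq (hε : 0 < ε) {n : ℕ} {a b p : E 2} (h : IsCap ε n a b p) :
    ∃ ω : ℕ → Bool, (capSeq ε ω n).start = a ∧ (capSeq ε ω n).finish = b ∧
      (capSeq ε ω n).apex = p := by
  induction h with
  | zero =>
    exact ⟨fun _ => false, rfl, capSeq_zero_finish _, capSeq_zero_apex _⟩
  | @left n a b p q _ hq hsub ih =>
    obtain ⟨ω, rfl, rfl, rfl⟩ := ih
    refine ⟨Function.update ω n false, ?_⟩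
    rw [capSeq, Function.update_self, capSeq_congr (ω' := ω)
      fun i hi => Function.update_of_ne hi.ne _ _]
    refine ⟨rfl, Cap.child_false_finish _ _, Eq.symm ?_⟩
    refine (hasShape_capSeq hε.le ω n).eq_apex_child hε (pow_pos (Cap.scale_pos ε) n) false ?_
      (hsub (subset_convexHull ℝ {_, _, q} (by simp)))
    rwa [Cap.child_false_finish, ← pow_succ']
  | @right n a b p q _ hq hsub ih =>
    obtain ⟨ω, rfl, rfl, rfl⟩ := ih
    refine ⟨Function.update ω n true, ?_⟩
    rw [capSeq, Function.update_self, capSeq_congr (ω' := ω)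
      fun i hi => Function.update_of_ne hi.ne _ _]
    refine ⟨rfl, Cap.child_true_finish _ _, Eq.symm ?_⟩
    refine (hasShape_capSeq hε.le ω n).eq_apex_child hε (pow_pos (Cap.scale_pos ε) n) true ?_
      (hsub (subset_convexHull ℝ {_, _, q} (by simp)))
    rwa [Cap.child_true_finish, ← pow_succ']

theorem mem_stage_iff (hε : 0 < ε) (hε' : ε < 1 / 2) {n : ℕ} {x : E 2} :
    x ∈ stage ε n ↔ ∃ ω : ℕ → Bool, x ∈ (capSeq ε ω n).hull := by
  constructor
  · rintro ⟨a, b, p, h, hx⟩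
    obtain ⟨ω, rfl, rfl, rfl⟩ := h.exists_capSeq hε
    exact ⟨ω, hx⟩
  · rintro ⟨ω, hx⟩
    exact ⟨_, _, _, isCap_capSeq hε.le (by nlinarith) ω n, hx⟩

theorem isLocallyConstant_capSeq (ε : ℝ) (n : ℕ) :
    IsLocallyConstant fun ω : ℕ → Bool => capSeq ε ω n := by
  induction n with
  | zero => exact IsLocallyConstant.const _
  | succ n ih =>
    exact ((IsLocallyConstant.iff_continuous _).2 (continuous_apply n)).comp₂ ih
      fun i c => Cap.child ε i c

/-- Every point of the Koch-like set has an infinite address, by compactness of the space of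
addresses. -/
theorem mem_Gam_iff (hε : 0 < ε) (hε' : ε < 1 / 2) {x : E 2} :
    x ∈ Gam ε ↔ ∃ ω : ℕ → Bool, ∀ n, x ∈ (capSeq ε ω n).hull := by
  simp only [Gam, Set.mem_iInter, mem_stage_iff hε hε']
  refine ⟨fun h => ?_, fun ⟨ω, hω⟩ n => ⟨ω, hω n⟩⟩
  have hcl : ∀ n, IsClosed {ω : ℕ → Bool | x ∈ (capSeq ε ω n).hull} := fun n =>
    ⟨isLocallyConstant_capSeq ε n {c | x ∉ c.hull}⟩
  obtain ⟨ω, hω⟩ := IsCompact.nonempty_iInter_of_sequence_nonempty_isCompact_isClosed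
    (fun n => {ω : ℕ → Bool | x ∈ (capSeq ε ω n).hull})
    (fun n ω hω => hull_capSeq_antitone (by nlinarith) ω n.le_succ hω) h (hcl 0).isCompact hcl
  exact ⟨ω, fun n => Set.mem_iInter.1 hω n⟩

/-- Along every address the caps shrink to a point. -/
theorem exists_forall_mem_hull_capSeq (hε : 0 ≤ ε) (hε' : ε < 1 / 2) (ω : ℕ → Bool) :
    ∃ x, ∀ n, x ∈ (capSeq ε ω n).hull := by
  have hc : ∀ n, IsCompact (capSeq ε ω n).hull := fun n =>
    (Set.toFinite _).isCompact_convexHull (𝕜 := ℝ)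
  obtain ⟨x, hx⟩ := IsCompact.nonempty_iInter_of_sequence_nonempty_isCompact_isClosed
    (fun n => (capSeq ε ω n).hull) (fun n => hull_capSeq_antitone (by nlinarith) ω n.le_succ)
    (fun n => ⟨_, Cap.start_mem_hull⟩) (hc 0) (fun n => (hc n).isClosed)
  exact ⟨x, fun n => Set.mem_iInter.1 hx n⟩

/-! ### Flatness -/

theorem scale_lt_one (hε0 : 0 ≤ ε) (hε : ε < 1 / 2) : scale ε < 1 := by
  have h1 := Cap.scale_sq ε
  have h2 := Cap.scale_pos ε
  nlinarith

theorem eq_of_forall_mem_hull_capSeq (hε0 : 0 ≤ ε) (hε : ε < 1 / 2) {ω : ℕ → Bool} {x y : E 2}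
    (hx : ∀ n, x ∈ (capSeq ε ω n).hull) (hy : ∀ n, y ∈ (capSeq ε ω n).hull) : x = y := by
  have hl := Cap.scale_pos ε
  have h1 : Filter.Tendsto (fun n : ℕ => 2 * scale ε ^ n) Filter.atTop (nhds (2 * 0)) :=
    (tendsto_pow_atTop_nhds_zero_of_lt_one hl.le (scale_lt_one hε0 hε)).const_mul 2
  have h2 : dist x y ≤ 2 * 0 := ge_of_tendsto' h1 fun n =>
    (hasShape_capSeq hε0 ω n).dist_le hε0 (by linarith) (by positivity) (hx n) (hy n)
  exact dist_le_zero.1 (by linarith)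

/-- The flatness estimate: a subset of the Koch-like set deviates from a suitable direction by at
most a small multiple of its diameter. The direction is the base of the smallest cap that
contains all points of the subset along their chosen addresses. -/
theorem exists_direction (hε0 : 0 < ε) (hε : ε < 1 / 2) {r : ℝ} (hr0 : 0 ≤ r) {S : Set (E 2)}
    (hS : S ⊆ Gam ε) (hr : ∀ x ∈ S, ∀ y ∈ S, dist x y ≤ r) :
    ∃ u : E 2, u ≠ 0 ∧ ∀ x ∈ S, ∀ y ∈ S, ∃ k : ℝ,
      ‖x - y - k • u‖ ≤ ε / (1 / 4 - ε ^ 2) * r := by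
  have hl := Cap.scale_pos ε
  have hκ : 0 < 1 / 4 - ε ^ 2 := by nlinarith
  have hadd : ∀ x, x ∈ S → ∃ ω : ℕ → Bool, ∀ n, x ∈ (capSeq ε ω n).hull :=
    fun x hx => (mem_Gam_iff hε0 hε).1 (hS hx)
  choose! ω hω using hadd
  have hne : ∀ (σ : ℕ → Bool) (n : ℕ), (capSeq ε σ n).base ≠ 0 := fun σ n => by
    rw [← norm_ne_zero_iff, (hasShape_capSeq hε0.le σ n).norm_base]
    positivity
  by_cases H : ∃ n, ∃ x ∈ S, ∃ y ∈ S, ω x n = false ∧ ω y n = true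
  · classical
    obtain ⟨x, hx, y, hy, hxn, hyn⟩ := Nat.find_spec H
    set n := Nat.find H with hn
    have hc : ∀ z ∈ S, capSeq ε (ω z) n = capSeq ε (ω x) n := by
      intro z hz
      refine capSeq_congr fun i hi => ?_
      have := Nat.find_min H hi
      push Not at this
      have h1 := this z hz x hx
      have h2 := this x hx z hz
      cases h3 : ω z i <;> cases h4 : ω x i <;> simp_all
    have hmem : ∀ z ∈ S, z ∈ (Cap.child ε (ω z n) (capSeq ε (ω x) n)).hull := by
      intro z hz
      have := hω z hz (n + 1)
      rwa [capSeq, hc z hz] at this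
    refine ⟨_, hne (ω x) n, (hasShape_capSeq hε0.le (ω x) n).exists_norm_sub_smul_base_le hε0.le hε
      (pow_pos hl n) hr (fun z hz => ?_) ⟨x, hx, ?_⟩ ⟨y, hy, ?_⟩⟩
    · have := hmem z hz
      cases h : ω z n
      · exact .inl (h ▸ this)
      · exact .inr (h ▸ this)
    · have := hmem x hx
      rwa [hxn] at this
    · have := hmem y hy
      rwa [hyn] at this
  · refine ⟨_, hne (fun _ => false) 0, fun x hx y hy => ⟨0, ?_⟩⟩
    have : ω x = ω y := by
      funext n
      push Not at H
      have h1 := H n x hx y hy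
      have h2 := H n y hy x hx
      cases h3 : ω x n <;> cases h4 : ω y n <;> simp_all
    have : x = y := eq_of_forall_mem_hull_capSeq hε0.le hε (hω x hx)
      (by rw [this]; exact hω y hy)
    rw [this, sub_self, zero_smul, sub_zero, norm_zero]
    positivity

theorem exists_affine_line {u : E 2} (hu : u ≠ 0) (y : E 2) :
    ∃ L : AffineSubspace ℝ (E 2), IsAffineOfDim 1 L ∧ ∀ k : ℝ, y + k • u ∈ L := by
  refine ⟨AffineSubspace.mk' y (ℝ ∙ u), ⟨AffineSubspace.mk'_nonempty _ _, ?_⟩, fun k => ?_⟩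
  · rw [AffineSubspace.direction_mk', finrank_span_singleton hu]
  · rw [AffineSubspace.mem_mk', vsub_eq_sub, add_sub_cancel_left]
    exact Submodule.mem_span_singleton.2 ⟨k, rfl⟩

/-- At all scales and around all centres, the Koch-like set is close to a line through any
prescribed point of the ball. -/
theorem exists_line_ball_inter_Gam_subset {δ : ℝ} (hε0 : 0 < ε) (hε : ε < 1 / 2)
    (hδ : 2 * (ε / (1 / 4 - ε ^ 2)) < δ) {ρ : ℝ} (hρ : 0 < ρ) {x y : E 2}
    (hy : y ∈ Metric.ball x ρ ∩ Gam ε) :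
    ∃ L : AffineSubspace ℝ (E 2), IsAffineOfDim 1 L ∧ y ∈ L ∧
      Metric.ball x ρ ∩ Gam ε ⊆ Metric.thickening (δ * ρ) (L : Set (E 2)) := by
  obtain ⟨u, hu, h⟩ := exists_direction hε0 hε (r := 2 * ρ) (by positivity)
    (S := Metric.ball x ρ ∩ Gam ε) Set.inter_subset_right fun z hz w hw => by
      have h1 := Metric.mem_ball.1 hz.1
      have h2 := Metric.mem_ball'.1 hw.1
      linarith [dist_triangle z x w]
  obtain ⟨L, hL, hmem⟩ := exists_affine_line hu y
  refine ⟨L, hL, by simpa using hmem 0, fun z hz => ?_⟩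
  obtain ⟨k, hk⟩ := h z hz y hy
  refine Metric.mem_thickening_iff.2 ⟨y + k • u, hmem k, ?_⟩
  rw [dist_eq_norm, ← sub_sub]
  nlinarith

theorem Gam_subset_ball (hε0 : 0 < ε) (hε : ε < 1 / 2) : ∃ z : E 2, Gam ε ⊆ Metric.ball z 1 := by
  let c := capSeq ε (fun _ => false) 0
  have hc : c.HasShape ε (scale ε ^ 0) := hasShape_capSeq hε0.le (fun _ => false) 0
  refine ⟨c.start + (1 / 2 : ℝ) • c.base, fun x hx => ?_⟩
  obtain ⟨ω, hω⟩ := (mem_Gam_iff hε0 hε).1 hx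
  obtain ⟨s, t, hs, ht, hst, rfl⟩ := Cap.mem_hull_iff.1 (hω 0)
  rw [Metric.mem_ball, dist_eq_norm, show capSeq ε ω 0 = c from rfl,
    show c.start + (s + t / 2) • c.base + t • c.height - (c.start + (1 / 2 : ℝ) • c.base) =
    (s + t / 2 - 1 / 2) • c.base + t • c.height by module]
  refine (norm_add_le _ _).trans_lt ?_
  rw [norm_smul, norm_smul, hc.norm_base, hc.norm_height, Real.norm_eq_abs,
    Real.norm_of_nonneg ht]
  have h1 : |s + t / 2 - 1 / 2| ≤ 1 / 2 - t / 2 := by rw [abs_le]; constructor <;> linarith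
  nlinarith

theorem uniformWeakApprox_Gam {δ : ℝ} (hε0 : 0 < ε) (hε : ε < 1 / 2)
    (hδ : 2 * (ε / (1 / 4 - ε ^ 2)) < δ) : UniformWeakApprox 1 δ 1 (Gam ε) :=
  ⟨Gam_subset_ball hε0 hε, fun _ hy _ hρ _ =>
    exists_line_ball_inter_Gam_subset hε0 hε hδ hρ ⟨Metric.mem_ball_self hρ, hy⟩⟩

theorem locallyUniformWeakApprox_Gam {δ : ℝ} (hε0 : 0 < ε) (hε : ε < 1 / 2)
    (hδ : 2 * (ε / (1 / 4 - ε ^ 2)) < δ) : LocallyUniformWeakApprox 1 δ (Gam ε) := by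
  refine fun _ _ => ⟨1, one_pos, fun ρ hρ _ x _ => ?_⟩
  rcases (Metric.ball x ρ ∩ Gam ε).eq_empty_or_nonempty with h | ⟨y, hy⟩
  · obtain ⟨u, hu⟩ := exists_ne (0 : E 2)
    obtain ⟨L, hL, -⟩ := exists_affine_line hu x
    exact ⟨L, hL, by simp [h]⟩
  · obtain ⟨L, hL, -, hsub⟩ := exists_line_ball_inter_Gam_subset hε0 hε hδ hρ hy
    exact ⟨L, hL, hsub⟩

/-! ### Binary expansions -/

/-- The left end point of the dyadic interval of length `2⁻ⁿ` given by the binary digits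
`ω 0, …, ω (n - 1)`. -/
noncomputable def leftEnd (ω : ℕ → Bool) : ℕ → ℝ
  | 0 => 0
  | n + 1 => leftEnd ω n + if ω n then (1 / 2) ^ (n + 1) else 0

/-- The digits `ω` are a binary expansion of `t`: all their dyadic intervals contain `t`. Dyadic
rationals have two expansions. -/
def IsExpansion (ω : ℕ → Bool) (t : ℝ) : Prop :=
  ∀ n, leftEnd ω n ≤ t ∧ t ≤ leftEnd ω n + (1 / 2) ^ n

theorem exists_isExpansion {t : ℝ} (ht : t ∈ Set.Icc (0 : ℝ) 1) : ∃ ω, IsExpansion ω t := by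
  -- Iterates of the doubling map on the unit interval.
  let f : ℝ → ℝ := fun s => if 1 / 2 ≤ s then 2 * s - 1 else 2 * s
  let s : ℕ → ℝ := fun n => f^[n] t
  have hs : ∀ n : ℕ, s (n + 1) = if 1 / 2 ≤ s n then 2 * s n - 1 else 2 * s n := fun n =>
    Function.iterate_succ_apply' f n t
  let ω : ℕ → Bool := fun n => decide (1 / 2 ≤ s n)
  have key : ∀ n, 0 ≤ s n ∧ s n ≤ 1 ∧ t = leftEnd ω n + s n * (1 / 2) ^ n := by
    intro n
    induction n with
    | zero => exact ⟨ht.1, ht.2, by simp [leftEnd, s]⟩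
    | succ n ih =>
      obtain ⟨h0, h1, h2⟩ := ih
      rw [hs, leftEnd]
      by_cases h : 1 / 2 ≤ s n
      · rw [if_pos h, if_pos (by simpa [ω] using h)]
        exact ⟨by linarith, by linarith, by rw [h2]; ring⟩
      · rw [if_neg h, if_neg (by simpa [ω] using h)]
        exact ⟨by linarith, by linarith, by rw [h2]; ring⟩
  refine ⟨ω, fun n => ?_⟩
  obtain ⟨h0, h1, h2⟩ := key n
  have : (0 : ℝ) < (1 / 2) ^ n := by positivity
  constructor <;> nlinarith

theorem leftEnd_congr {ω ω' : ℕ → Bool} {n : ℕ} (h : ∀ i < n, ω i = ω' i) :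
    leftEnd ω n = leftEnd ω' n := by
  induction n with
  | zero => rfl
  | succ n ih => rw [leftEnd, leftEnd, ih fun i hi => h i (by omega), h n (by omega)]

theorem eq_of_forall_le_half_pow {a b : ℝ} (n : ℕ) (hab : a ≤ b)
    (h : ∀ k, n ≤ k → b - a ≤ (1 / 2) ^ k) : a = b := by
  have h1 : Filter.Tendsto (fun n : ℕ => (1 / 2 : ℝ) ^ n) Filter.atTop (nhds 0) :=
    tendsto_pow_atTop_nhds_zero_of_lt_one (by norm_num) (by norm_num)
  have := ge_of_tendsto h1 ((Filter.eventually_ge_atTop n).mono h)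
  linarith

theorem IsExpansion.eq {ω : ℕ → Bool} {t u : ℝ} (ht : IsExpansion ω t) (hu : IsExpansion ω u) :
    t = u := by
  rcases le_total t u with h | h
  · exact eq_of_forall_le_half_pow 0 h fun k _ => by linarith [(ht k).1, (hu k).2]
  · exact (eq_of_forall_le_half_pow 0 h fun k _ => by linarith [(hu k).1, (ht k).2]).symm

/-! ### The inverse parametrization is Hölder continuous -/

theorem leftEnd_and_start_eq {ω : ℕ → Bool} {n k : ℕ} (hnk : n ≤ k)
    (h : ∀ i, n ≤ i → i < k → ω i = false) :
    leftEnd ω k = leftEnd ω n ∧ (capSeq ε ω k).start = (capSeq ε ω n).start := by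
  induction k, hnk using Nat.le_induction with
  | base => exact ⟨rfl, rfl⟩
  | succ k hk ih =>
    obtain ⟨h1, h2⟩ := ih fun i hi hik => h i hi (by omega)
    simp [leftEnd, capSeq, h k hk (by omega), h1, h2]

theorem rightEnd_and_finish_eq {ω : ℕ → Bool} {n k : ℕ} (hnk : n ≤ k)
    (h : ∀ i, n ≤ i → i < k → ω i = true) :
    leftEnd ω k + (1 / 2) ^ k = leftEnd ω n + (1 / 2) ^ n ∧
      (capSeq ε ω k).finish = (capSeq ε ω n).finish := by
  induction k, hnk using Nat.le_induction with
  | base => exact ⟨rfl, rfl⟩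
  | succ k hk ih =>
    obtain ⟨h1, h2⟩ := ih fun i hi hik => h i hi (by omega)
    simp only [leftEnd, capSeq, h k hk (by omega), Cap.child_true_finish, h2, if_true, and_true,
      ← h1]
    ring

variable {α : ℝ}

/-- The distance of a point to the start of a cap of its address dominates the `α`-th power of the
parameter distance. The first digit `1` decides about both. -/
theorem half_mul_rpow_le_dist_start (hε0 : 0 ≤ ε) (hε : ε < 1 / 2) (hα0 : 0 < α)
    (hα : ((1 / 2 : ℝ)) ^ α = scale ε) {ω : ℕ → Bool} {t : ℝ} {x : E 2} (ht : IsExpansion ω t)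
    (hx : ∀ n, x ∈ (capSeq ε ω n).hull) (n : ℕ) :
    1 / 2 * (t - leftEnd ω n) ^ α ≤ dist x (capSeq ε ω n).start := by
  have hl := Cap.scale_pos ε
  by_cases H : ∃ k, n ≤ k ∧ ω k = true
  · classical
    obtain ⟨hnk, hk⟩ := Nat.find_spec H
    set k := Nat.find H
    obtain ⟨h1, h2⟩ := leftEnd_and_start_eq (ε := ε) hnk fun i hi hik => by
      have := Nat.find_min H hik
      simpa [hi] using this
    have h3 := hx (k + 1)
    rw [capSeq, hk] at h3
    have h4 := (hasShape_capSeq hε0 ω k).half_le_dist_start (by nlinarith) (by positivity) h3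
    rw [← h1, ← h2]
    have h5 : (t - leftEnd ω k) ^ α ≤ ((1 / 2 : ℝ) ^ k) ^ α :=
      Real.rpow_le_rpow (by linarith [(ht k).1]) (by linarith [(ht k).2]) hα0.le
    rw [← Real.rpow_pow_comm (by norm_num), hα] at h5
    linarith
  · push Not at H
    have : leftEnd ω n = t := eq_of_forall_le_half_pow n (ht n).1 fun k hk => by
      obtain ⟨h1, -⟩ := leftEnd_and_start_eq (ε := ε) hk fun i hi _ => by simpa using H i hi
      linarith [(ht k).2]
    rw [this, sub_self, Real.zero_rpow hα0.ne', mul_zero]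
    exact dist_nonneg

/-- The mirror image of `half_mul_rpow_le_dist_start`. -/
theorem half_mul_rpow_le_dist_finish (hε0 : 0 ≤ ε) (hε : ε < 1 / 2) (hα0 : 0 < α)
    (hα : ((1 / 2 : ℝ)) ^ α = scale ε) {ω : ℕ → Bool} {t : ℝ} {x : E 2} (ht : IsExpansion ω t)
    (hx : ∀ n, x ∈ (capSeq ε ω n).hull) (n : ℕ) :
    1 / 2 * (leftEnd ω n + (1 / 2) ^ n - t) ^ α ≤ dist x (capSeq ε ω n).finish := by
  have hl := Cap.scale_pos ε
  by_cases H : ∃ k, n ≤ k ∧ ω k = false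
  · classical
    obtain ⟨hnk, hk⟩ := Nat.find_spec H
    set k := Nat.find H
    obtain ⟨h1, h2⟩ := rightEnd_and_finish_eq (ε := ε) hnk fun i hi hik => by
      have := Nat.find_min H hik
      simpa [hi] using this
    have h3 := hx (k + 1)
    rw [capSeq, hk] at h3
    have h4 := (hasShape_capSeq hε0 ω k).half_le_dist_finish (by nlinarith) (by positivity) h3
    rw [← h1, ← h2]
    have h5 : (leftEnd ω k + (1 / 2) ^ k - t) ^ α ≤ ((1 / 2 : ℝ) ^ k) ^ α :=
      Real.rpow_le_rpow (by linarith [(ht k).2]) (by linarith [(ht k).1]) hα0.le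
    rw [← Real.rpow_pow_comm (by norm_num), hα] at h5
    linarith
  · push Not at H
    have : t = leftEnd ω n + (1 / 2) ^ n := eq_of_forall_le_half_pow n (ht n).2 fun k hk => by
      obtain ⟨h1, -⟩ := rightEnd_and_finish_eq (ε := ε) hk fun i hi _ => by simpa using H i hi
      linarith [(ht k).1]
    rw [this, sub_self, Real.zero_rpow hα0.ne', mul_zero]
    exact dist_nonneg

theorem rpow_add_le_add_rpow {a b : ℝ} (ha : 0 ≤ a) (hb : 0 ≤ b) (hα0 : 0 ≤ α) (hα1 : α ≤ 1) :
    (a + b) ^ α ≤ a ^ α + b ^ α := by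
  lift a to NNReal using ha
  lift b to NNReal using hb
  exact_mod_cast NNReal.rpow_add_le_add_rpow a b hα0 hα1

/-- Points whose parameters are separated by the first differing binary digit are far apart: their
caps meet in a vertex only, and both points are controlled near it. -/
theorem mul_rpow_le_dist_of_digits (hε0 : 0 ≤ ε) (hε : ε < 1 / 2) (hα0 : 0 < α) (hα1 : α ≤ 1)
    (hα : ((1 / 2 : ℝ)) ^ α = scale ε) {ω ω' : ℕ → Bool} {t u : ℝ} {x y : E 2}
    (ht : IsExpansion ω t) (hu : IsExpansion ω' u) (hx : ∀ n, x ∈ (capSeq ε ω n).hull)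
    (hy : ∀ n, y ∈ (capSeq ε ω' n).hull) {n : ℕ} (hn : ∀ i < n, ω i = ω' i) (h0 : ω n = false)
    (h1 : ω' n = true) : (1 / 4 - ε ^ 2) / 4 * |t - u| ^ α ≤ dist x y := by
  have hκ : 0 < 1 / 4 - ε ^ 2 := by nlinarith
  have hl := Cap.scale_pos ε
  have e1 := half_mul_rpow_le_dist_finish hε0 hε hα0 hα ht hx (n + 1)
  have e2 := half_mul_rpow_le_dist_start hε0 hε hα0 hα hu hy (n + 1)
  have t1 := (ht (n + 1)).2
  have u1 := (hu (n + 1)).1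
  have hx' := hx (n + 1)
  have hy' := hy (n + 1)
  simp only [capSeq, leftEnd, h0, h1, ← capSeq_congr hn, ← leftEnd_congr hn,
    Cap.child_false_finish, Cap.child_true_start, if_true, Bool.false_eq_true, if_false,
    add_zero] at e1 e2 t1 u1 hx' hy'
  have e3 := (hasShape_capSeq hε0 ω n).mul_dist_add_dist_le hε0 hε (by positivity) hx' hy'
  have e4 := rpow_add_le_add_rpow (sub_nonneg.2 t1) (sub_nonneg.2 u1) hα0.le hα1
  have e5 : |t - u| = leftEnd ω n + (1 / 2) ^ (n + 1) - t +
      (u - (leftEnd ω n + (1 / 2) ^ (n + 1))) := by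
    rw [abs_of_nonpos (by linarith)]
    ring
  rw [← e5] at e4
  refine le_trans ?_ e3
  calc (1 / 4 - ε ^ 2) / 4 * |t - u| ^ α = (1 / 4 - ε ^ 2) / 2 * (1 / 2 * |t - u| ^ α) := by ring
    _ ≤ _ := by
      gcongr
      linarith

theorem mul_rpow_le_dist (hε0 : 0 ≤ ε) (hε : ε < 1 / 2) (hα0 : 0 < α) (hα1 : α ≤ 1)
    (hα : ((1 / 2 : ℝ)) ^ α = scale ε) {ω ω' : ℕ → Bool} {t u : ℝ} {x y : E 2}
    (ht : IsExpansion ω t) (hu : IsExpansion ω' u) (hx : ∀ n, x ∈ (capSeq ε ω n).hull)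
    (hy : ∀ n, y ∈ (capSeq ε ω' n).hull) : (1 / 4 - ε ^ 2) / 4 * |t - u| ^ α ≤ dist x y := by
  by_cases H : ∃ n, ω n ≠ ω' n
  · classical
    have hn := Nat.find_spec H
    have hmin : ∀ i < Nat.find H, ω i = ω' i := fun i hi => by simpa using Nat.find_min H hi
    cases h0 : ω (Nat.find H)
    · exact mul_rpow_le_dist_of_digits hε0 hε hα0 hα1 hα ht hu hx hy hmin h0
        (by simpa [h0] using hn.symm)
    · rw [abs_sub_comm, dist_comm]
      exact mul_rpow_le_dist_of_digits hε0 hε hα0 hα1 hα hu ht hy hx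
        (fun i hi => (hmin i hi).symm) (by simpa [h0] using hn.symm) h0
  · push Not at H
    obtain rfl : ω = ω' := funext H
    rw [ht.eq hu, sub_self, abs_zero, Real.zero_rpow hα0.ne', mul_zero]
    exact dist_nonneg

/-! ### Hausdorff dimension -/

theorem log_scale_neg (hε0 : 0 ≤ ε) (hε : ε < 1 / 2) : Real.log (scale ε) < 0 :=
  Real.log_neg (Cap.scale_pos ε) (scale_lt_one hε0 hε)

theorem one_lt_neg_log_div_log_scale (hε0 : 0 < ε) (hε : ε < 1 / 2) :
    1 < -Real.log 2 / Real.log (scale ε) := by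
  have hl := Cap.scale_pos ε
  have h1 : (1 / 2 : ℝ) < scale ε := by
    have := Cap.scale_sq ε
    nlinarith
  have h2 := Real.log_lt_log (by norm_num) h1
  rw [one_div, Real.log_inv] at h2
  rw [lt_div_iff_of_neg (log_scale_neg hε0.le hε)]
  linarith

theorem scale_rpow_eq (hε0 : 0 ≤ ε) (hε : ε < 1 / 2) :
    scale ε ^ (-Real.log 2 / Real.log (scale ε)) = 1 / 2 := by
  rw [Real.rpow_def_of_pos (Cap.scale_pos ε), mul_div_cancel₀ _ (log_scale_neg hε0 hε).ne,
    Real.exp_neg, Real.exp_log two_pos, one_div]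

/-- The caps of stage `n` cover, and their `s`-th powers of diameters have bounded sum. -/
theorem dimH_Gam_le (hε0 : 0 < ε) (hε : ε < 1 / 2) {s : NNReal} (hs : scale ε ^ (s : ℝ) = 1 / 2) :
    dimH (Gam ε) ≤ s := by
  have hl := Cap.scale_pos ε
  let ext : (n : ℕ) → (Fin n → Bool) → ℕ → Bool :=
    fun n w i => if h : i < n then w ⟨i, h⟩ else false
  have hdiam : ∀ n (w : Fin n → Bool), Metric.ediam (capSeq ε (ext n w) n).hull ≤
      ENNReal.ofReal (2 * scale ε ^ n) := by
    intro n w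
    refine Metric.ediam_le fun x hx y hy => ?_
    rw [edist_dist]
    exact ENNReal.ofReal_le_ofReal
      ((hasShape_capSeq hε0.le _ n).dist_le hε0.le (by linarith) (by positivity) hx hy)
  refine dimH_le_of_hausdorffMeasure_ne_top (ne_top_of_le_ne_top (b := ENNReal.ofReal (2 ^ (s : ℝ)))
    ENNReal.ofReal_ne_top ?_)
  refine (MeasureTheory.Measure.hausdorffMeasure_le_liminf_sum (l := Filter.atTop) (s : ℝ) (Gam ε)
    (fun n : ℕ => ENNReal.ofReal (2 * scale ε ^ n)) ?_
    (fun n w => (capSeq ε (ext n w) n).hull) (.of_forall hdiam) (.of_forall fun n x hx => ?_)).trans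
    ?_
  · have h1 : Filter.Tendsto (fun n : ℕ => 2 * scale ε ^ n) Filter.atTop (nhds (2 * 0)) :=
      (tendsto_pow_atTop_nhds_zero_of_lt_one hl.le (scale_lt_one hε0.le hε)).const_mul 2
    simpa using ENNReal.tendsto_ofReal h1
  · obtain ⟨ω, hω⟩ := (mem_Gam_iff hε0 hε).1 hx
    refine Set.mem_iUnion.2 ⟨fun i => ω i, ?_⟩
    rw [capSeq_congr (ω' := ω) fun i hi => by simp [ext, hi]]
    exact hω n
  · have hsum : ∀ n : ℕ, ∑ w : Fin n → Bool, Metric.ediam (capSeq ε (ext n w) n).hull ^ (s : ℝ) ≤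
        ENNReal.ofReal (2 ^ (s : ℝ)) := by
      intro n
      calc _ ≤ ∑ _w : Fin n → Bool, ENNReal.ofReal (2 * scale ε ^ n) ^ (s : ℝ) :=
            Finset.sum_le_sum fun w _ => ENNReal.rpow_le_rpow (hdiam n w) s.coe_nonneg
        _ = ENNReal.ofReal (2 ^ n * (2 * scale ε ^ n) ^ (s : ℝ)) := by
            rw [ENNReal.ofReal_rpow_of_nonneg (by positivity) s.coe_nonneg, Finset.sum_const,
              Finset.card_univ, Fintype.card_fun, Fintype.card_bool, Fintype.card_fin,
              nsmul_eq_mul, ENNReal.ofReal_mul (by positivity), ENNReal.ofReal_pow (by norm_num)]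
            simp
        _ = ENNReal.ofReal (2 ^ (s : ℝ)) := by
            rw [Real.mul_rpow (by norm_num) (by positivity), ← Real.rpow_pow_comm hl.le, hs]
            congr 1
            rw [mul_left_comm, ← mul_pow]
            norm_num
    exact (Filter.liminf_le_liminf (.of_forall hsum)).trans (by simp)

/-- A set of points of the Koch-like set, one for each parameter in the unit interval, is mapped
onto that interval by a Hölder continuous map with exponent `s`. -/
theorem le_dimH_Gam (hε0 : 0 < ε) (hε : ε < 1 / 2) {s : NNReal} (hs1 : 1 ≤ s)
    (hs : scale ε ^ (s : ℝ) = 1 / 2) : (s : ENNReal) ≤ dimH (Gam ε) := by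
  have hl := Cap.scale_pos ε
  have hκ : 0 < 1 / 4 - ε ^ 2 := by nlinarith
  have hs0 : 0 < s := one_pos.trans_le hs1
  have hs0' : (0 : ℝ) < s := hs0
  have hα : (1 / 2 : ℝ) ^ (s : ℝ)⁻¹ = scale ε := by
    rw [← hs, Real.rpow_rpow_inv hl.le hs0'.ne']
  have hex : ∀ t ∈ Set.Icc (0 : ℝ) 1, ∃ (ω : ℕ → Bool) (x : E 2), IsExpansion ω t ∧
      ∀ n, x ∈ (capSeq ε ω n).hull := fun t ht => by
    obtain ⟨ω, hω⟩ := exists_isExpansion ht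
    obtain ⟨x, hx⟩ := exists_forall_mem_hull_capSeq hε0.le hε ω
    exact ⟨ω, x, hω, hx⟩
  choose! ω γ hω hγ using hex
  have hsep : ∀ t ∈ Set.Icc (0 : ℝ) 1, ∀ u ∈ Set.Icc (0 : ℝ) 1,
      (1 / 4 - ε ^ 2) / 4 * |t - u| ^ (s : ℝ)⁻¹ ≤ dist (γ t) (γ u) := fun t ht u hu =>
    mul_rpow_le_dist hε0.le hε (by positivity) (inv_le_one_of_one_le₀ (by exact_mod_cast hs1)) hα
      (hω t ht) (hω u hu) (hγ t ht) (hγ u hu)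
  have hinj : Set.InjOn γ (Set.Icc 0 1) := by
    intro t ht u hu htu
    have h1 := hsep t ht u hu
    rw [htu, dist_self] at h1
    by_contra hne
    have : 0 < |t - u| := abs_pos.2 (sub_ne_zero.2 hne)
    have : 0 < (1 / 4 - ε ^ 2) / 4 * |t - u| ^ (s : ℝ)⁻¹ := by positivity
    linarith
  let C : NNReal := ⟨(4 / (1 / 4 - ε ^ 2)) ^ (s : ℝ), by positivity⟩
  have hhol : HolderOnWith C s (Function.invFunOn γ (Set.Icc 0 1)) (γ '' Set.Icc 0 1) := by
    rintro _ ⟨t, ht, rfl⟩ _ ⟨u, hu, rfl⟩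
    rw [hinj.leftInvOn_invFunOn ht, hinj.leftInvOn_invFunOn hu, edist_dist, edist_dist,
      ENNReal.ofReal_rpow_of_nonneg dist_nonneg s.coe_nonneg, ← ENNReal.ofReal_coe_nnreal,
      ← ENNReal.ofReal_mul C.coe_nonneg]
    refine ENNReal.ofReal_le_ofReal ?_
    have h1 := hsep t ht u hu
    rw [Real.dist_eq, show (C : ℝ) = (4 / (1 / 4 - ε ^ 2)) ^ (s : ℝ) from rfl, ← Real.mul_rpow (by positivity) dist_nonneg]
    have h2 : |t - u| ^ (s : ℝ)⁻¹ ≤ 4 / (1 / 4 - ε ^ 2) * dist (γ t) (γ u) := by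
      rw [div_mul_eq_mul_div, le_div_iff₀ hκ]
      linarith
    calc |t - u| = (|t - u| ^ (s : ℝ)⁻¹) ^ (s : ℝ) :=
          (Real.rpow_inv_rpow (abs_nonneg _) hs0'.ne').symm
      _ ≤ _ := Real.rpow_le_rpow (by positivity) h2 s.coe_nonneg
  have h1 := hhol.dimH_image_le hs0
  rw [hinj.leftInvOn_invFunOn.image_image,
    Real.dimH_of_nonempty_interior (by rw [interior_Icc]; exact ⟨1 / 2, by norm_num⟩),
    Module.finrank_self, Nat.cast_one, ENNReal.le_div_iff_mul_le (.inl (by simpa using hs0.ne'))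
      (.inl (by simp)), one_mul] at h1
  refine h1.trans (dimH_mono ?_)
  rintro _ ⟨t, ht, rfl⟩
  exact (mem_Gam_iff hε0 hε).2 ⟨ω t, hγ t ht⟩

theorem dimH_Gam (hε0 : 0 < ε) (hε : ε < 1 / 2) :
    dimH (Gam ε) = ENNReal.ofReal (-Real.log 2 / Real.log (scale ε)) := by
  have h1 := one_lt_neg_log_div_log_scale hε0 hε
  have h2 := scale_rpow_eq hε0.le hε
  have h3 : ((-Real.log 2 / Real.log (scale ε)).toNNReal : ℝ) =
      -Real.log 2 / Real.log (scale ε) := Real.coe_toNNReal _ (by linarith)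
  refine le_antisymm (dimH_Gam_le hε0 hε (by rw [h3, h2])) (le_dimH_Gam hε0 hε ?_ (by rw [h3, h2]))
  rw [← NNReal.coe_le_coe, h3]
  exact h1.le

/-- A set of dimension greater than `j` has a point all of whose neighbourhoods in the set have
dimension greater than `j`. -/
theorem not_weakLocallyFiniteHausdorff_of_lt_dimH {n j : ℕ} {A : Set (E n)}
    (h : (j : ENNReal) < dimH A) : ¬ WeakLocallyFiniteHausdorff j A := by
  intro hA
  obtain ⟨y, hy, hd⟩ := exists_mem_nhdsWithin_lt_dimH_of_lt_dimH h
  obtain ⟨ρ, hρ, hfin⟩ := hA y hy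
  have h1 := hd _ (Filter.inter_mem (mem_nhdsWithin_of_mem_nhds (Metric.ball_mem_nhds y hρ))
    self_mem_nhdsWithin)
  have h2 := hausdorffMeasure_of_lt_dimH (d := (j : NNReal)) (by exact_mod_cast h1)
  rw [NNReal.coe_natCast] at h2
  exact hfin.ne h2

theorem LocallyFiniteHausdorff.weakLocallyFiniteHausdorff {n j : ℕ} {A : Set (E n)}
    (h : LocallyFiniteHausdorff j A) : WeakLocallyFiniteHausdorff j A := fun y _ =>
  ⟨1, one_pos, (MeasureTheory.measure_mono
    (Set.inter_subset_inter_left A Metric.ball_subset_closedBall)).trans_lt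
      (h _ (isCompact_closedBall y 1))⟩

theorem one_lt_dimH_Gam (hε0 : 0 < ε) (hε : ε < 1 / 2) : 1 < dimH (Gam ε) := by
  rw [dimH_Gam hε0 hε, ENNReal.one_lt_ofReal]
  exact one_lt_neg_log_div_log_scale hε0 hε

theorem not_weakLocallyFiniteHausdorff_Gam (hε0 : 0 < ε) (hε : ε < 1 / 2) :
    ¬ WeakLocallyFiniteHausdorff 1 (Gam ε) :=
  not_weakLocallyFiniteHausdorff_of_lt_dimH (by simpa using one_lt_dimH_Gam hε0 hε)

/-- The slope bound tends to zero with `ε`. -/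
theorem exists_slope_lt {δ : ℝ} (hδ : 0 < δ) :
    ∃ ε : ℝ, 0 < ε ∧ ε < 1 / 2 ∧ 2 * (ε / (1 / 4 - ε ^ 2)) < δ := by
  refine ⟨min (1 / 4) (δ / 12), by positivity, by
    linarith [min_le_left (1 / 4 : ℝ) (δ / 12)], ?_⟩
  set ε := min (1 / 4 : ℝ) (δ / 12)
  have h1 : ε ≤ 1 / 4 := min_le_left _ _
  have h2 : ε ≤ δ / 12 := min_le_right _ _
  have h0 : 0 < ε := by positivity
  have h3 : (3 / 16 : ℝ) ≤ 1 / 4 - ε ^ 2 := by nlinarith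
  rw [← mul_div_assoc, div_lt_iff₀ (by linarith)]
  nlinarith

end KochType

theorem theorem5 :
    -- flatness: the uniform property (v) with radius 1, and property (ii)
    (∀ δ : ℝ, 0 < δ → ∃ ε : ℝ, 0 < ε ∧ ε < 1 / 2 ∧
      KochType.UniformWeakApprox 1 δ 1 (KochType.Gam ε) ∧
      KochType.LocallyUniformWeakApprox 1 δ (KochType.Gam ε)) ∧
    -- dimension, and failure of weak local finiteness
    (∀ ε : ℝ, 0 < ε → ε < 1 / 2 →
      dimH (KochType.Gam ε)
        = ENNReal.ofReal (-Real.log 2 / Real.log (KochType.scale ε)) ∧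
      1 < -Real.log 2 / Real.log (KochType.scale ε) ∧
      ¬ KochType.WeakLocallyFiniteHausdorff 1 (KochType.Gam ε)) ∧
    -- the answers, for every δ
    (∀ δ : ℝ, 0 < δ →
      -- (v) (1)
      (¬ ∀ A : Set (KochType.E 2),
        (∃ ρ₀ : ℝ, 0 < ρ₀ ∧ KochType.UniformWeakApprox 1 δ ρ₀ A) → dimH A ≤ 1) ∧
      -- (v) (2), for both strengths of local finiteness
      (¬ ∀ A : Set (KochType.E 2),
        (∃ ρ₀ : ℝ, 0 < ρ₀ ∧ KochType.UniformWeakApprox 1 δ ρ₀ A) →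
          KochType.WeakLocallyFiniteHausdorff 1 A) ∧
      (¬ ∀ A : Set (KochType.E 2),
        (∃ ρ₀ : ℝ, 0 < ρ₀ ∧ KochType.UniformWeakApprox 1 δ ρ₀ A) →
          KochType.LocallyFiniteHausdorff 1 A) ∧
      -- (ii) (1)
      (¬ ∀ A : Set (KochType.E 2),
        KochType.LocallyUniformWeakApprox 1 δ A → dimH A ≤ 1) ∧
      -- (ii) (2), for both strengths of local finiteness
      (¬ ∀ A : Set (KochType.E 2),
        KochType.LocallyUniformWeakApprox 1 δ A →
          KochType.WeakLocallyFiniteHausdorff 1 A) ∧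
      (¬ ∀ A : Set (KochType.E 2),
        KochType.LocallyUniformWeakApprox 1 δ A →
          KochType.LocallyFiniteHausdorff 1 A)) := by
  have approx : ∀ δ : ℝ, 0 < δ → ∃ ε : ℝ, 0 < ε ∧ ε < 1 / 2 ∧
      KochType.UniformWeakApprox 1 δ 1 (KochType.Gam ε) ∧
      KochType.LocallyUniformWeakApprox 1 δ (KochType.Gam ε) := by
    intro δ hδ
    obtain ⟨ε, hε0, hε, h⟩ := KochType.exists_slope_lt hδ
    exact ⟨ε, hε0, hε, KochType.uniformWeakApprox_Gam hε0 hε h,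
      KochType.locallyUniformWeakApprox_Gam hε0 hε h⟩
  refine ⟨approx, fun ε hε0 hε => ⟨KochType.dimH_Gam hε0 hε,
    KochType.one_lt_neg_log_div_log_scale hε0 hε,
    KochType.not_weakLocallyFiniteHausdorff_Gam hε0 hε⟩, fun δ hδ => ?_⟩
  obtain ⟨ε, hε0, hε, hv, hii⟩ := approx δ hδ
  have hdim := (KochType.one_lt_dimH_Gam hε0 hε).not_ge
  have hw := KochType.not_weakLocallyFiniteHausdorff_Gam hε0 hε
  have hs : ¬ KochType.LocallyFiniteHausdorff 1 (KochType.Gam ε) :=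
    fun h => hw h.weakLocallyFiniteHausdorff
  exact ⟨fun H => hdim (H _ ⟨1, one_pos, hv⟩), fun H => hw (H _ ⟨1, one_pos, hv⟩),
    fun H => hs (H _ ⟨1, one_pos, hv⟩), fun H => hdim (H _ hii), fun H => hw (H _ hii),
    fun H => hs (H _ hii)⟩
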